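/- Let $q,k_1,u_1\in\mathbb C^{*}$ with $q^m\neq 1$ for all integers $m>0$, and fix a square root $q^{1/2}$ of $q$. Let $\mathbb T_q$ be the quantum torus: the unital associative $\mathbb C$-algebra generated by the exponentials $e^{n\cdot S}$, $n\cdot S=n_1S_1+n_2S_2+n_3S_3$, $n\in\mathbb Z^3$, where formally $[S_1,S_2]=[S_2,S_3]=[S_3,S_1]=i\pi\hbar$, $q=e^{-i\pi\hbar}$ and $q^{1/2}=e^{-i\pi\hbar/2}$. That is, the defining relations are $e^{0}=1$, $e^{m\cdot S}e^{n\cdot S}=q^{-\omega(m,n)/2}\,e^{(m+n)\cdot S}$ with $\omega(m,n)=(m_1n_2-m_2n_1)+(m_2n_3-m_3n_2)+(m_3n_1-m_1n_3)$, together with the normalization of the central element $e^{S_1+S_2+S_3}=-i\,q^{-1/2}$. Let $\mathcal H_{III}$ be the unital associative $\mathbb C$-algebra with generators $V_0,V_1,\check V_0,\check V_1$ and defining relations $$V_0^2=0,\qquad (V_1-k_1)(V_1+k_1^{-1})=0,\qquad \check V_0^2+q^{-1/2}\check V_0=0,\qquad (\check V_1-u_1)(\check V_1+u_1^{-1})=0,$$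 $$q^{1/2}\check V_1V_1V_0=\check V_0+q^{-1/2},\qquad q^{1/2}\check V_0\check V_1V_1=V_0 .$$ Consider the following matrices in $Mat(2,\mathbb T_q)$ (in a product of matrices the entries of the left factor are kept on the left): $$V_0\mapsto\begin{pmatrix}0&0\\ i e^{S_3}&0\end{pmatrix},\qquad V_1\mapsto\begin{pmatrix}k_1-k_1^{-1}-ie^{S_2}&k_1-k_1^{-1}-ie^{-S_2}-ie^{S_2}\\ ie^{S_2}&ie^{S_2}\end{pmatrix},$$ $$\check V_1\mapsto\begin{pmatrix}0&-ie^{S_1}\\ ie^{-S_1}&u_1-u_1^{-1}\end{pmatrix},\qquad \check V_0\mapsto\begin{pmatrix}0&0\\ s&-q^{-1/2}\end{pmatrix},$$ $$s=(k_1^{-1}-k_1)e^{-S_1+S_3}+(u_1^{-1}-u_1)e^{S_2+S_3}+ie^{-S_1-S_2+S_3}+ie^{-S_1+S_2+S_3}.$$ Then these four matrices satisfy the six defining relations of $\mathcal H_{III}$, and the resulting homomorphism of unital $\mathbb C$-algebras $\mathcal H_{III}\to Mat(2,\mathbb T_q)$ is injective, that is, an embedding. -/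

import Mathlib

/-- The skew-symmetric integer form with `[m·S, n·S] = torusForm m n * (iπħ)`, where
`m·S = m₁S₁ + m₂S₂ + m₃S₃` and `[S₁,S₂] = [S₂,S₃] = [S₃,S₁] = iπħ`. -/
def torusForm (m n : Fin 3 → ℤ) : ℤ :=
  (m 0 * n 1 - m 1 * n 0) + (m 1 * n 2 - m 2 * n 1) + (m 2 * n 0 - m 0 * n 2)

/-- Defining relations of the quantum torus. The generator indexed by `n` is the exponential
`e^{n·S}`. With `q = e^{-iπħ}` and `r = q^{1/2} = e^{-iπħ/2}`, the Baker-Campbell-Hausdorff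
formula reads `e^{m·S} e^{n·S} = e^{[m·S, n·S]/2} e^{(m+n)·S}`, with scalar `r ^ (-torusForm m n)`.
The last relation fixes the value of the central exponential `e^{S₁+S₂+S₃}` to `-i q^{-1/2}`,
that is, `u₀ = -i e^{-S₁-S₂-S₃}` with `u₀ = q^{1/2}`. -/
inductive QuantumTorusRel (r : ℂ) :
    FreeAlgebra ℂ (Fin 3 → ℤ) → FreeAlgebra ℂ (Fin 3 → ℤ) → Prop
  | one : QuantumTorusRel r (FreeAlgebra.ι ℂ 0) 1
  | mul (m n : Fin 3 → ℤ) : QuantumTorusRel r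
      (FreeAlgebra.ι ℂ m * FreeAlgebra.ι ℂ n)
      (r ^ (-torusForm m n) • FreeAlgebra.ι ℂ (m + n))
  | central : QuantumTorusRel r (FreeAlgebra.ι ℂ ![1, 1, 1])
      (algebraMap ℂ (FreeAlgebra ℂ (Fin 3 → ℤ)) (-Complex.I * r⁻¹))

/-- The quantum torus `𝕋_q`, for a chosen square root `r` of `q`. -/
def QuantumTorus (r : ℂ) : Type := RingQuot (QuantumTorusRel r)

noncomputable instance (r : ℂ) : Ring (QuantumTorus r) :=
  inferInstanceAs (Ring (RingQuot (QuantumTorusRel r)))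

noncomputable instance (r : ℂ) : Algebra ℂ (QuantumTorus r) :=
  inferInstanceAs (Algebra ℂ (RingQuot (QuantumTorusRel r)))

/-- The quotient map onto the quantum torus. -/
noncomputable def QuantumTorus.mk (r : ℂ) :
    FreeAlgebra ℂ (Fin 3 → ℤ) →ₐ[ℂ] QuantumTorus r :=
  RingQuot.mkAlgHom ℂ (QuantumTorusRel r)

/-- The element `e^{a S₁ + b S₂ + c S₃}` of the quantum torus. -/
noncomputable def expS (r : ℂ) (a b c : ℤ) : QuantumTorus r :=
  QuantumTorus.mk r (FreeAlgebra.ι ℂ ![a, b, c])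

/-- Names of the four generators `V₀, V₁, V̌₀, V̌₁`. -/
inductive HIIIGen : Type
  | V0 | V1 | V0check | V1check

/-- Free generators. -/
noncomputable abbrev HIIIGen.free (g : HIIIGen) : FreeAlgebra ℂ HIIIGen := FreeAlgebra.ι ℂ g

open HIIIGen in
/-- Defining relations of the confluent Cherednik algebra `H_III`, with `r = √q`. -/
inductive HIIIRel (r k₁ u₁ : ℂ) : FreeAlgebra ℂ HIIIGen → FreeAlgebra ℂ HIIIGen → Prop
  | rel1 : HIIIRel r k₁ u₁ (V0.free ^ 2) 0
  | rel2 : HIIIRel r k₁ u₁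
      ((V1.free - algebraMap ℂ _ k₁) * (V1.free + algebraMap ℂ _ k₁⁻¹)) 0
  | rel3 : HIIIRel r k₁ u₁ (V0check.free ^ 2 + r⁻¹ • V0check.free) 0
  | rel4 : HIIIRel r k₁ u₁
      ((V1check.free - algebraMap ℂ _ u₁) * (V1check.free + algebraMap ℂ _ u₁⁻¹)) 0
  | rel5 : HIIIRel r k₁ u₁
      (r • (V1check.free * V1.free * V0.free)) (V0check.free + algebraMap ℂ _ r⁻¹)
  | rel6 : HIIIRel r k₁ u₁ (r • (V0check.free * V1check.free * V1.free)) V0.free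

/-- The confluent Cherednik algebra `H_III`. -/
def HIII (r k₁ u₁ : ℂ) : Type := RingQuot (HIIIRel r k₁ u₁)

noncomputable instance (r k₁ u₁ : ℂ) : Ring (HIII r k₁ u₁) :=
  inferInstanceAs (Ring (RingQuot (HIIIRel r k₁ u₁)))

noncomputable instance (r k₁ u₁ : ℂ) : Algebra ℂ (HIII r k₁ u₁) :=
  inferInstanceAs (Algebra ℂ (RingQuot (HIIIRel r k₁ u₁)))

/-- The quotient map onto `H_III`. -/
noncomputable def HIII.mk (r k₁ u₁ : ℂ) : FreeAlgebra ℂ HIIIGen →ₐ[ℂ] HIII r k₁ u₁ :=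
  RingQuot.mkAlgHom ℂ (HIIIRel r k₁ u₁)

/-- The generators of `H_III`. -/
noncomputable def HIII.gen (r k₁ u₁ : ℂ) (g : HIIIGen) : HIII r k₁ u₁ :=
  HIII.mk r k₁ u₁ g.free

/-- The `2 × 2` matrices over the quantum torus. As always for matrices over a noncommutative
ring, the entries of the left factor of a product stay on the left. -/
abbrev MatTq (r : ℂ) : Type := Matrix (Fin 2) (Fin 2) (QuantumTorus r)

/-- The matrix assigned to `V₀`. -/
noncomputable def matV0 (r : ℂ) : MatTq r :=
  !![0, 0;
     Complex.I • expS r 0 0 1, 0]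

/-- The matrix assigned to `V₁`. -/
noncomputable def matV1 (r k₁ : ℂ) : MatTq r :=
  !![algebraMap ℂ _ (k₁ - k₁⁻¹) - Complex.I • expS r 0 1 0,
      algebraMap ℂ _ (k₁ - k₁⁻¹) - Complex.I • expS r 0 (-1) 0 - Complex.I • expS r 0 1 0;
     Complex.I • expS r 0 1 0, Complex.I • expS r 0 1 0]

/-- The matrix assigned to `V̌₁`. -/
noncomputable def matV1check (r u₁ : ℂ) : MatTq r :=
  !![0, -(Complex.I • expS r 1 0 0);
     Complex.I • expS r (-1) 0 0, algebraMap ℂ _ (u₁ - u₁⁻¹)]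

/-- The entry `s` of the matrix assigned to `V̌₀`. -/
noncomputable def entryS (r k₁ u₁ : ℂ) : QuantumTorus r :=
  (k₁⁻¹ - k₁) • expS r (-1) 0 1 + (u₁⁻¹ - u₁) • expS r 0 1 1
    + Complex.I • expS r (-1) (-1) 1 + Complex.I • expS r (-1) 1 1

/-- The matrix assigned to `V̌₀`. -/
noncomputable def matV0check (r k₁ u₁ : ℂ) : MatTq r :=
  !![0, 0;
     entryS r k₁ u₁, -algebraMap ℂ _ r⁻¹]

/-! The six matrix identities are direct computations. Injectivity compares a spanning set of
`H_III` with an explicit action.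

Put w = V̌₁V₁, a = V₁, x = V₀. The quadratic relations make w invertible, and the mixed relations
eliminate V̌₀, leaving r² w x w = x + w. Hence a and x move past powers of w at the cost of shorter
terms, and x² = 0 truncates alternating words, so the words wⁿ aᵉ (xa)ᵐ xᶠ with e, f ∈ {0, 1} span
(`HIII.wordSpan_eq_top`).

Through the matrices, `H_III` acts on pairs of formal series in e^{S₂}, e^{S₃}. The vacuum is killed
by x and also lies in the image of x. Writing an element of the kernel as y + z x, with y and z
combinations of words with f = 0, evaluation at the vacuum and then at a preimage of it reduces the
claim to independence of the columns wⁿ aᵉ (xa)ᵐ · vacuum (`linearIndependent_leftWordVacuum`). The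
factor (xa)ᵐ creates S₃-degree m and S₂-degrees exactly reaching ±m, while wⁿ lowers the bottom
S₃-degree by |n|. Suitable extreme coefficients therefore form a triangular system. -/

/-! ### Torus exponentials and the six matrix identities. -/

theorem expS_mul (r : ℂ) (a b c a' b' c' : ℤ) :
    expS r a b c * expS r a' b' c' =
      r ^ (-((a * b' - b * a') + (b * c' - c * b') + (c * a' - a * c'))) •
        expS r (a + a') (b + b') (c + c') := by
  have h := RingQuot.mkAlgHom_rel ℂ (QuantumTorusRel.mul (r := r) ![a, b, c] ![a', b', c'])
  have e : (![a, b, c] + ![a', b', c'] : Fin 3 → ℤ) = ![a + a', b + b', c + c'] := by simp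
  rw [e, map_mul, map_smul] at h
  exact h

theorem expS_zero (r : ℂ) : expS r 0 0 0 = 1 := by
  have h := RingQuot.mkAlgHom_rel ℂ (QuantumTorusRel.one (r := r))
  have e : (0 : Fin 3 → ℤ) = ![0, 0, 0] := by ext i; fin_cases i <;> rfl
  rw [e, map_one] at h
  exact h

theorem expS_central (r : ℂ) :
    expS r 1 1 1 = algebraMap ℂ (QuantumTorus r) (-Complex.I * r⁻¹) := by
  have h := RingQuot.mkAlgHom_rel ℂ (QuantumTorusRel.central (r := r))
  rw [AlgHom.commutes] at h
  exact h

theorem expS_eq_smul_shift {r : ℂ} (hr : r ≠ 0) (a b c : ℤ) :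
    expS r a b c = (Complex.I * r) • expS r (a + 1) (b + 1) (c + 1) := by
  have h : expS r a b c * expS r 1 1 1 = expS r (a + 1) (b + 1) (c + 1) := by
    rw [expS_mul]
    have e : -(a * 1 - b * 1 + (b * 1 - c * 1) + (c * 1 - a * 1)) = 0 := by ring
    rw [e, zpow_zero, one_smul]
  rw [← h, expS_central, Algebra.algebraMap_eq_smul_one, mul_smul_comm, mul_one, smul_smul]
  have e : Complex.I * r * (-Complex.I * r⁻¹) = 1 := by
    field_simp
    linear_combination -Complex.I_sq
  rw [e, one_smul]

theorem matV0_sq (r : ℂ) : matV0 r ^ 2 = 0 := by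
  rw [sq, matV0]
  ext i j
  fin_cases i <;> fin_cases j <;> simp [Matrix.mul_apply]

theorem matV1_quadratic {r k₁ : ℂ} (hk : k₁ ≠ 0) :
    (matV1 r k₁ - algebraMap ℂ (MatTq r) k₁) * (matV1 r k₁ + algebraMap ℂ (MatTq r) k₁⁻¹) = 0 := by
  have h1 : expS r 0 1 0 * expS r 0 (-1) 0 = 1 := by
    rw [expS_mul]; simp [expS_zero]
  have h2 : expS r 0 (-1) 0 * expS r 0 1 0 = 1 := by
    rw [expS_mul]; simp [expS_zero]
  ext i j
  fin_cases i <;> fin_cases j <;>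
    simp [matV1, Matrix.mul_apply, Fin.sum_univ_two, mul_add,
      sub_mul, mul_sub, h1, h2, Algebra.algebraMap_eq_smul_one, smul_smul, hk, smul_sub,
      sub_smul] <;>
    module

theorem matV1check_quadratic {r u₁ : ℂ} (hu : u₁ ≠ 0) :
    (matV1check r u₁ - algebraMap ℂ (MatTq r) u₁) *
      (matV1check r u₁ + algebraMap ℂ (MatTq r) u₁⁻¹) = 0 := by
  have h1 : expS r 1 0 0 * expS r (-1) 0 0 = 1 := by
    rw [expS_mul]; simp [expS_zero]
  have h2 : expS r (-1) 0 0 * expS r 1 0 0 = 1 := by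
    rw [expS_mul]; simp [expS_zero]
  ext i j
  fin_cases i <;> fin_cases j <;>
    simp [matV1check, Matrix.mul_apply, Fin.sum_univ_two, mul_add,
      sub_mul, mul_sub, h1, h2, Algebra.algebraMap_eq_smul_one, smul_smul, hu, smul_sub,
      sub_smul] <;>
    module

theorem matV0check_quadratic {r k₁ u₁ : ℂ} :
    matV0check r k₁ u₁ ^ 2 + r⁻¹ • matV0check r k₁ u₁ = 0 := by
  rw [sq]
  ext i j
  fin_cases i <;> fin_cases j <;>
    simp [matV0check, Algebra.algebraMap_eq_smul_one]

theorem matV1check_mul_matV1_mul_matV0 {r k₁ u₁ : ℂ} (hr : r ≠ 0) :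
    r • (matV1check r u₁ * matV1 r k₁ * matV0 r) =
      matV0check r k₁ u₁ + algebraMap ℂ (MatTq r) r⁻¹ := by
  ext i j
  fin_cases i <;> fin_cases j
  · simp [matV1check, matV1, matV0, matV0check,
      expS_mul, expS_central, smul_smul, Algebra.algebraMap_eq_smul_one]
    congr 1
    field_simp
    -- This is i⁴ = 1.
    linear_combination (Complex.I ^ 2 - 1) * Complex.I_sq
  · simp [matV1check, matV1, matV0, matV0check, Matrix.algebraMap_matrix_apply]
  · simp [matV1check, matV1, matV0, matV0check, entryS,
      expS_mul, smul_smul,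
      Algebra.algebraMap_eq_smul_one, add_mul, mul_sub, sub_mul, smul_sub, sub_smul]
    generalize k₁⁻¹ = k', u₁⁻¹ = u'
    match_scalars <;> field_simp <;> simp [pow_succ]
  · simp [matV1check, matV1, matV0, matV0check, Matrix.algebraMap_matrix_apply]

theorem matV0check_mul_matV1check_mul_matV1 {r k₁ u₁ : ℂ} (hr : r ≠ 0) :
    r • (matV0check r k₁ u₁ * matV1check r u₁ * matV1 r k₁) = matV0 r := by
  ext i j
  fin_cases i <;> fin_cases j
  · simp [matV1check, matV1, matV0, matV0check]
  · simp [matV1check, matV1, matV0, matV0check]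
  · simp [matV1check, matV1, matV0, matV0check, entryS,
      expS_mul, smul_smul,
      Algebra.algebraMap_eq_smul_one, add_mul, mul_sub, sub_mul, smul_sub, sub_smul]
    -- Exponentials differing by S₁ + S₂ + S₃ are proportional; this brings such terms to a common
    -- representative, so that scalars can be matched.
    rw [expS_eq_smul_shift hr (-1) 1 0, expS_eq_smul_shift hr (-1) 0 0, expS_eq_smul_shift hr 0 1 0]
    norm_num only
    generalize k₁⁻¹ = k', u₁⁻¹ = u'
    match_scalars <;> field_simp <;> simp [pow_succ]
  · simp [matV1check, matV1, matV0, matV0check, entryS,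
      expS_mul, smul_smul,
      Algebra.algebraMap_eq_smul_one, add_mul, mul_sub, sub_mul, smul_sub, sub_smul]
    rw [expS_eq_smul_shift hr (-1) 1 0, expS_eq_smul_shift hr (-1) 0 0,
      expS_eq_smul_shift hr (-1) (-1) 0, expS_eq_smul_shift hr 0 1 0]
    norm_num only
    generalize k₁⁻¹ = k', u₁⁻¹ = u'
    match_scalars <;> field_simp <;> simp [pow_succ]

/-! ### Action of the torus and of its matrices on coefficient arrays. -/

/-- The operator by which `e^{n·S}` acts on arrays of coefficients, in which the entry at `(s, p)`
is the coefficient of `e^{s S₂ + p S₃}`. -/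
noncomputable def torusOp (r : ℂ) (n : Fin 3 → ℤ) : Module.End ℂ (ℤ → ℤ → ℂ) where
  toFun f s p := (-Complex.I * r⁻¹) ^ n 0 * r ^ ((n 2 - n 0) * s - (n 1 - n 0) * p) *
    f (s - (n 1 - n 0)) (p - (n 2 - n 0))
  map_add' f g := by
    funext s p
    simp only [Pi.add_apply]
    ring
  map_smul' c f := by
    funext s p
    simp only [Pi.smul_apply, smul_eq_mul, RingHom.id_apply]
    ring

/-- Modulo the central direction, n is the displacement (n₁ - n₀, n₂ - n₀). The form `torusForm`
depends only on these displacements, and it appears when the outer operator shifts the point where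
the inner power of r is evaluated. -/
theorem torusOp_mul {r : ℂ} (hr : r ≠ 0) (m n : Fin 3 → ℤ) :
    torusOp r m * torusOp r n = r ^ (-torusForm m n) • torusOp r (m + n) := by
  have hc : -Complex.I * r⁻¹ ≠ 0 := mul_ne_zero (neg_ne_zero.2 Complex.I_ne_zero) (inv_ne_zero hr)
  ext f s p
  simp only [torusOp, Module.End.mul_apply, LinearMap.coe_mk, AddHom.coe_mk, LinearMap.smul_apply,
    Pi.smul_apply, smul_eq_mul, Pi.add_apply, zpow_add₀ hc]
  have e : (m 2 - m 0) * s - (m 1 - m 0) * p + ((n 2 - n 0) * (s - (m 1 - m 0)) -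
      (n 1 - n 0) * (p - (m 2 - m 0))) = -torusForm m n +
      ((m 2 + n 2 - (m 0 + n 0)) * s - (m 1 + n 1 - (m 0 + n 0)) * p) := by
    rw [torusForm]
    ring
  have e' : r ^ ((m 2 - m 0) * s - (m 1 - m 0) * p) * r ^ ((n 2 - n 0) * (s - (m 1 - m 0)) -
      (n 1 - n 0) * (p - (m 2 - m 0))) = r ^ (-torusForm m n) *
      r ^ ((m 2 + n 2 - (m 0 + n 0)) * s - (m 1 + n 1 - (m 0 + n 0)) * p) := by
    rw [← zpow_add₀ hr, ← zpow_add₀ hr, e]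
  have es : s - (m 1 - m 0) - (n 1 - n 0) = s - (m 1 + n 1 - (m 0 + n 0)) := by ring
  have ep : p - (m 2 - m 0) - (n 2 - n 0) = p - (m 2 + n 2 - (m 0 + n 0)) := by ring
  rw [es, ep]
  linear_combination ((-Complex.I * r⁻¹) ^ m 0 * (-Complex.I * r⁻¹) ^ n 0 *
    f (s - (m 1 + n 1 - (m 0 + n 0))) (p - (m 2 + n 2 - (m 0 + n 0)))) * e'

theorem torusOp_rel {r : ℂ} (hr : r ≠ 0) ⦃x y : FreeAlgebra ℂ (Fin 3 → ℤ)⦄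
    (h : QuantumTorusRel r x y) :
    FreeAlgebra.lift ℂ (torusOp r) x = FreeAlgebra.lift ℂ (torusOp r) y := by
  cases h with
  | one =>
    ext f s p
    simp [torusOp]
  | mul m n => simp [torusOp_mul hr]
  | central =>
    ext f s p
    simp [torusOp, Module.algebraMap_end_apply]
    ring

/-- The regular representation of the quantum torus. -/
noncomputable def torusRep {r : ℂ} (hr : r ≠ 0) :
    QuantumTorus r →ₐ[ℂ] Module.End ℂ (ℤ → ℤ → ℂ) :=
  RingQuot.liftAlgHom ℂ ⟨FreeAlgebra.lift ℂ (torusOp r), torusOp_rel hr⟩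

theorem torusRep_expS {r : ℂ} (hr : r ≠ 0) (a b c : ℤ) :
    torusRep hr (expS r a b c) = torusOp r ![a, b, c] := by
  have h := RingQuot.liftAlgHom_mkAlgHom_apply ℂ (FreeAlgebra.lift ℂ (torusOp r))
    (torusOp_rel hr) (FreeAlgebra.ι ℂ ![a, b, c])
  rw [FreeAlgebra.lift_ι_apply] at h
  exact h

/-- The action of `2 × 2` matrices over the quantum torus on columns of coefficient arrays. -/
noncomputable def matRep {r : ℂ} (hr : r ≠ 0) :
    MatTq r →ₐ[ℂ] Module.End ℂ (Fin 2 → ℤ → ℤ → ℂ) :=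
  ((endVecAlgEquivMatrixEnd (Fin 2) ℂ ℂ (ℤ → ℤ → ℂ)).symm : _ →ₐ[ℂ] _).comp
    (torusRep hr).mapMatrix

theorem matRep_apply {r : ℂ} (hr : r ≠ 0) (A : MatTq r) (v : Fin 2 → ℤ → ℤ → ℂ) :
    matRep hr A v =
      ![torusRep hr (A 0 0) (v 0) + torusRep hr (A 0 1) (v 1),
        torusRep hr (A 1 0) (v 0) + torusRep hr (A 1 1) (v 1)] := by
  have h (i : Fin 2) : matRep hr A v i = ∑ j, torusRep hr (A i j) (v j) := rfl
  ext1 i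
  rw [h, Fin.sum_univ_two]
  fin_cases i <;> rfl


theorem matRep_V0 {r : ℂ} (hr : r ≠ 0) (v : Fin 2 → ℤ → ℤ → ℂ) :
    matRep hr (matV0 r) v = ![0, fun s p => Complex.I * r ^ s * v 0 s (p - 1)] := by
  rw [matRep_apply]
  ext i s p
  fin_cases i
  · simp [matV0]
  · simp [matV0, torusRep_expS, torusOp]
    ring

theorem matRep_V1 {r : ℂ} (k₁ : ℂ) (hr : r ≠ 0) (v : Fin 2 → ℤ → ℤ → ℂ) :
    matRep hr (matV1 r k₁) v =
      ![fun s p => (k₁ - k₁⁻¹) * (v 0 s p + v 1 s p)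
          - Complex.I * r ^ (-p) * (v 0 (s - 1) p + v 1 (s - 1) p)
          - Complex.I * r ^ p * v 1 (s + 1) p,
        fun s p => Complex.I * r ^ (-p) * (v 0 (s - 1) p + v 1 (s - 1) p)] := by
  rw [matRep_apply]
  ext i s p
  fin_cases i
  · simp [matV1, torusRep_expS, torusOp, Algebra.algebraMap_eq_smul_one]
    ring
  · simp [matV1, torusRep_expS, torusOp]
    ring

theorem matRep_V1check {r : ℂ} (u₁ : ℂ) (hr : r ≠ 0) (v : Fin 2 → ℤ → ℤ → ℂ) :
    matRep hr (matV1check r u₁) v =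
      ![fun s p => -(r⁻¹ * r ^ (p - s) * v 1 (s + 1) (p + 1)),
        fun s p => -(r * r ^ (s - p) * v 0 (s - 1) (p - 1)) + (u₁ - u₁⁻¹) * v 1 s p] := by
  rw [matRep_apply]
  ext i s p
  fin_cases i
  · simp [matV1check, torusRep_expS, torusOp]
    rw [show -s + p = p - s by ring]
    linear_combination (r⁻¹ * r ^ (p - s) * v 1 (s + 1) (p + 1)) * Complex.I_sq
  · simp [matV1check, torusRep_expS, torusOp, Algebra.algebraMap_eq_smul_one]
    linear_combination (r * r ^ (s - p) * v 0 (s - 1) (p - 1)) * Complex.I_sq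

/-! ### Normal-form words and stability of their span under left multiplication. -/

section NormalForm

variable {A : Type*} [Ring A] [Algebra ℂ A]

/-- The word `wⁿ aᵉ (x a)ᵐ`, where `e` is `0` or `1`. -/
def leftWord (w : Aˣ) (a x : A) (i : ℤ × Bool × ℕ) : A :=
  ((w ^ i.1 : Aˣ) : A) * ((if i.2.1 then a else 1) * (x * a) ^ i.2.2)

/-- The span of the words `wⁿ aᵉ (x a)ᵐ xᶠ`, where `e` and `f` are `0` or `1`. -/
def wordSpan (w : Aˣ) (a x : A) : Submodule ℂ A :=
  Submodule.span ℂ (Set.range (leftWord w a x)) ⊔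
    (Submodule.span ℂ (Set.range (leftWord w a x))).map (LinearMap.mulRight ℂ x)

variable {w : Aˣ} {a x : A}

theorem leftWord_mem_wordSpan (i : ℤ × Bool × ℕ) : leftWord w a x i ∈ wordSpan w a x :=
  Submodule.mem_sup_left (Submodule.subset_span ⟨i, rfl⟩)

theorem leftWord_mul_mem_wordSpan (i : ℤ × Bool × ℕ) : leftWord w a x i * x ∈ wordSpan w a x :=
  Submodule.mem_sup_right ⟨_, Submodule.subset_span ⟨i, rfl⟩, rfl⟩

theorem mul_mem_wordSpan_of_words {y : A} (h : ∀ i, y * leftWord w a x i ∈ wordSpan w a x)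
    (h' : ∀ i, y * (leftWord w a x i * x) ∈ wordSpan w a x) {z : A}
    (hz : z ∈ wordSpan w a x) : y * z ∈ wordSpan w a x := by
  have key : wordSpan w a x ≤ (wordSpan w a x).comap (LinearMap.mulLeft ℂ y) := by
    conv_lhs => rw [wordSpan]
    rw [Submodule.map_span, sup_le_iff, Submodule.span_le, Submodule.span_le]
    constructor
    · rintro _ ⟨i, rfl⟩
      exact h i
    · rintro _ ⟨_, ⟨i, rfl⟩, rfl⟩
      exact h' i
  exact key hz

theorem zpow_mul_mem_wordSpan (k : ℤ) {z : A} (hz : z ∈ wordSpan w a x) :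
    ((w ^ k : Aˣ) : A) * z ∈ wordSpan w a x := by
  have h (i : ℤ × Bool × ℕ) :
      ((w ^ k : Aˣ) : A) * leftWord w a x i = leftWord w a x (k + i.1, i.2) := by
    simp only [leftWord, zpow_add, Units.val_mul, mul_assoc]
  refine mul_mem_wordSpan_of_words (fun i => ?_) (fun i => ?_) hz
  · rw [h]
    exact leftWord_mem_wordSpan _
  · rw [← mul_assoc, h]
    exact leftWord_mul_mem_wordSpan _

/-- If `y w` and `y w⁻¹` can be rewritten with `y` on the right, it suffices to check stability
under `y` on the words in `a` and `x`. -/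
theorem mul_mem_wordSpan_of_comm {y : A} {c c₁ c₂ d₁ d₂ d₃ : ℂ}
    (hu : y * w = c • (((w⁻¹ : Aˣ) : A) * y) + c₁ • (w : A) + algebraMap ℂ A c₂)
    (hd : y * ((w⁻¹ : Aˣ) : A) = d₁ • ((w : A) * y) + d₂ • (w : A) + algebraMap ℂ A d₃)
    (h : ∀ e m, y * leftWord w a x (0, e, m) ∈ wordSpan w a x)
    (h' : ∀ e m, y * (leftWord w a x (0, e, m) * x) ∈ wordSpan w a x) {z : A}
    (hz : z ∈ wordSpan w a x) : y * z ∈ wordSpan w a x := by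
  -- Induct outwards from n = 0 with u fixed: `hu` and `hd` each peel off one factor w or w⁻¹, and
  -- the correction terms are powers of w times u.
  have step (n : ℤ) (u : A) (h0 : ∀ k : ℤ, ((w ^ k : Aˣ) : A) * u ∈ wordSpan w a x)
      (h1 : y * u ∈ wordSpan w a x) : y * (((w ^ n : Aˣ) : A) * u) ∈ wordSpan w a x := by
    induction n with
    | zero => simpa using h1
    | succ i ih =>
      have e : y * (((w ^ ((i : ℤ) + 1) : Aˣ) : A) * u) =
          c • (((w ^ (-1 : ℤ) : Aˣ) : A) * (y * (((w ^ (i : ℤ) : Aˣ) : A) * u))) +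
          c₁ • (((w ^ ((i : ℤ) + 1) : Aˣ) : A) * u) +
          c₂ • (((w ^ (i : ℤ) : Aˣ) : A) * u) := by
        rw [add_comm (i : ℤ) 1, zpow_add, zpow_one, zpow_neg_one, Units.val_mul, mul_assoc,
          ← mul_assoc y, hu]
        simp only [add_mul, smul_mul_assoc, Algebra.algebraMap_eq_smul_one, one_mul, mul_assoc]
      rw [e]
      exact add_mem (add_mem (Submodule.smul_mem _ _ (zpow_mul_mem_wordSpan _ ih))
        (Submodule.smul_mem _ _ (h0 _))) (Submodule.smul_mem _ _ (h0 _))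
    | pred i ih =>
      have e : y * (((w ^ (-(i : ℤ) - 1) : Aˣ) : A) * u) =
          d₁ • (((w ^ (1 : ℤ) : Aˣ) : A) * (y * (((w ^ (-(i : ℤ)) : Aˣ) : A) * u))) +
          d₂ • (((w ^ (1 + -(i : ℤ)) : Aˣ) : A) * u) +
          d₃ • (((w ^ (-(i : ℤ)) : Aˣ) : A) * u) := by
        rw [sub_eq_neg_add, zpow_add, zpow_add _ 1, zpow_one, zpow_neg_one, Units.val_mul,
          Units.val_mul, mul_assoc, ← mul_assoc y, hd]
        simp only [add_mul, smul_mul_assoc, Algebra.algebraMap_eq_smul_one, one_mul, mul_assoc]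
      rw [e]
      exact add_mem (add_mem (Submodule.smul_mem _ _ (zpow_mul_mem_wordSpan _ ih))
        (Submodule.smul_mem _ _ (h0 _))) (Submodule.smul_mem _ _ (h0 _))
  have hw (n : ℤ) (e : Bool) (m : ℕ) :
      leftWord w a x (n, e, m) = ((w ^ n : Aˣ) : A) * leftWord w a x (0, e, m) := by
    simp [leftWord]
  refine mul_mem_wordSpan_of_words ?_ ?_ hz
  · rintro ⟨n, e, m⟩
    rw [hw]
    refine step n _ (fun k => ?_) (h e m)
    rw [← hw]
    exact leftWord_mem_wordSpan _
  · rintro ⟨n, e, m⟩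
    rw [hw, mul_assoc]
    refine step n _ (fun k => ?_) (h' e m)
    rw [← mul_assoc, ← hw]
    exact leftWord_mul_mem_wordSpan _

theorem mul_mem_wordSpan_of_quadratic {κ t : ℂ} (ha : a * a = κ • a + 1)
    (hu : a * w = ((w⁻¹ : Aˣ) : A) * a + κ • (w : A) + algebraMap ℂ A t)
    (hd : a * ((w⁻¹ : Aˣ) : A) = (w : A) * a - κ • (w : A) - algebraMap ℂ A t) {z : A}
    (hz : z ∈ wordSpan w a x) : a * z ∈ wordSpan w a x := by
  have h (e : Bool) (m : ℕ) : a * leftWord w a x (0, e, m) = if e then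
      κ • leftWord w a x (0, true, m) + leftWord w a x (0, false, m)
      else leftWord w a x (0, true, m) := by
    cases e
    · simp [leftWord]
    · simp [leftWord, ← mul_assoc, ha, add_mul]
  refine mul_mem_wordSpan_of_comm (c := 1) (c₁ := κ) (c₂ := t) (d₁ := 1) (d₂ := -κ) (d₃ := -t)
    (by simpa using hu) (by simpa [sub_eq_add_neg] using hd) (fun e m => ?_) (fun e m => ?_) hz
  · rw [h]
    split_ifs
    · exact add_mem (Submodule.smul_mem _ _ (leftWord_mem_wordSpan _)) (leftWord_mem_wordSpan _)
    · exact leftWord_mem_wordSpan _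
  · rw [← mul_assoc, h]
    split_ifs
    · rw [add_mul, smul_mul_assoc]
      exact add_mem (Submodule.smul_mem _ _ (leftWord_mul_mem_wordSpan _))
        (leftWord_mul_mem_wordSpan _)
    · exact leftWord_mul_mem_wordSpan _

/-- Once x is past the power of w, it either completes a factor xa, meets another x and vanishes, or
meets the empty word and gives x itself, which lies in the second summand of `wordSpan`. -/
theorem mul_mem_wordSpan_of_sq_zero {c : ℂ} (hc : c ≠ 0) (hx : x * x = 0)
    (hxw : c • ((w : A) * x) = x * ((w⁻¹ : Aˣ) : A) + 1)
    (hxw' : c • (x * (w : A)) = ((w⁻¹ : Aˣ) : A) * x + 1) {z : A}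
    (hz : z ∈ wordSpan w a x) : x * z ∈ wordSpan w a x := by
  have h1 (m : ℕ) : x * leftWord w a x (0, true, m) = leftWord w a x (0, false, m + 1) := by
    simp [leftWord, pow_succ', mul_assoc]
  have h2 (m : ℕ) : x * leftWord w a x (0, false, m + 1) = 0 := by
    simp [leftWord, pow_succ', ← mul_assoc, hx]
  have h3 : leftWord w a x (0, false, 0) = 1 := by simp [leftWord]
  refine mul_mem_wordSpan_of_comm (c := c⁻¹) (c₁ := 0) (c₂ := c⁻¹) (d₁ := c) (d₂ := 0) (d₃ := -1)
    ?_ ?_ (fun e m => ?_) (fun e m => ?_) hz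
  · rw [zero_smul, add_zero, Algebra.algebraMap_eq_smul_one, ← smul_add, ← hxw', smul_smul,
      inv_mul_cancel₀ hc, one_smul]
  · rw [zero_smul, add_zero, hxw, map_neg, map_one]
    abel
  · cases e
    · cases m
      · have h4 := leftWord_mul_mem_wordSpan (w := w) (a := a) (x := x) (0, false, 0)
        rw [h3, one_mul] at h4
        rwa [h3, mul_one]
      · rw [h2]
        exact zero_mem _
    · rw [h1]
      exact leftWord_mem_wordSpan _
  · rw [← mul_assoc]
    cases e
    · cases m
      · rw [h3, mul_one, hx]
        exact zero_mem _
      · rw [h2, zero_mul]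
        exact zero_mem _
    · rw [h1]
      exact leftWord_mul_mem_wordSpan _

end NormalForm

/-! ### Quadratic relations and the unit they produce. -/

theorem mul_self_of_quadratic {A : Type*} [Ring A] [Algebra ℂ A] {a : A} {k : ℂ} (hk : k ≠ 0)
    (h : (a - algebraMap ℂ A k) * (a + algebraMap ℂ A k⁻¹) = 0) :
    a * a = (k - k⁻¹) • a + 1 := by
  have e : (a - algebraMap ℂ A k) * (a + algebraMap ℂ A k⁻¹) =
      a * a - ((k - k⁻¹) • a + 1) := by
    simp only [Algebra.algebraMap_eq_smul_one, sub_mul, mul_add, mul_smul_comm, smul_mul_assoc,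
      mul_one, one_mul]
    match_scalars <;> field_simp
    ring
  exact sub_eq_zero.1 (e ▸ h)

/-- The product `b a` of two elements satisfying `a² = κ a + 1` and `b² = t b + 1`, as a unit. -/
def quadraticUnit {A : Type*} [Ring A] [Algebra ℂ A] {a b : A} {κ t : ℂ}
    (ha : a * a = κ • a + 1) (hb : b * b = t • b + 1) : Aˣ where
  val := b * a
  inv := (a - algebraMap ℂ A κ) * (b - algebraMap ℂ A t)
  val_inv := by
    have h : a * (a - algebraMap ℂ A κ) = 1 := by
      rw [mul_sub, ha, ← Algebra.commutes, ← Algebra.smul_def, add_sub_cancel_left]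
    rw [mul_assoc, ← mul_assoc a, h, one_mul, mul_sub, hb, ← Algebra.commutes, ← Algebra.smul_def,
      add_sub_cancel_left]
  inv_val := by
    have h : (b - algebraMap ℂ A t) * b = 1 := by
      rw [sub_mul, hb, ← Algebra.smul_def, add_sub_cancel_left]
    rw [mul_assoc, ← mul_assoc _ b, h, one_mul, sub_mul, ha, ← Algebra.smul_def,
      add_sub_cancel_left]

section quadraticUnit

variable {A : Type*} [Ring A] [Algebra ℂ A] {a b : A} {κ t : ℂ}
  (ha : a * a = κ • a + 1) (hb : b * b = t • b + 1)

/-- Both sides come from aba, since w = ba and w⁻¹ = (a - κ)(b - t); the correction terms are those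
of a² = κa + 1. -/
theorem mul_quadraticUnit : a * (quadraticUnit ha hb : A) =
    (((quadraticUnit ha hb)⁻¹ : Aˣ) : A) * a + κ • (quadraticUnit ha hb : A) +
      algebraMap ℂ A t := by
  change a * (b * a) = (a - algebraMap ℂ A κ) * (b - algebraMap ℂ A t) * a + κ • (b * a) + _
  simp only [Algebra.algebraMap_eq_smul_one, sub_mul, mul_sub, mul_smul_comm, smul_mul_assoc,
    mul_one, one_mul, mul_assoc, ha]
  module

theorem mul_quadraticUnit_inv : a * (((quadraticUnit ha hb)⁻¹ : Aˣ) : A) =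
    (quadraticUnit ha hb : A) * a - κ • (quadraticUnit ha hb : A) - algebraMap ℂ A t := by
  change a * ((a - algebraMap ℂ A κ) * (b - algebraMap ℂ A t)) = b * a * a - κ • (b * a) - _
  have h : a * (a - algebraMap ℂ A κ) = 1 := by
    rw [mul_sub, ha, ← Algebra.commutes, ← Algebra.smul_def, add_sub_cancel_left]
  rw [← mul_assoc, h, one_mul, mul_assoc, ha, mul_add, mul_smul_comm, mul_one, add_sub_cancel_left]

end quadraticUnit

/-! ### Rewriting rules in `H_III`, the spanning set, and the homomorphism. -/

namespace HIII

open HIIIGen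

variable {r k₁ u₁ : ℂ}

theorem gen_V0_mul_self : gen r k₁ u₁ V0 * gen r k₁ u₁ V0 = 0 := by
  have h := RingQuot.mkAlgHom_rel ℂ (HIIIRel.rel1 (r := r) (k₁ := k₁) (u₁ := u₁))
  rw [map_pow, sq, map_zero] at h
  exact h

theorem gen_V1_mul_self (hk : k₁ ≠ 0) :
    gen r k₁ u₁ V1 * gen r k₁ u₁ V1 = (k₁ - k₁⁻¹) • gen r k₁ u₁ V1 + 1 := by
  have h := RingQuot.mkAlgHom_rel ℂ (HIIIRel.rel2 (r := r) (k₁ := k₁) (u₁ := u₁))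
  rw [map_mul, map_sub, map_add, AlgHom.commutes, AlgHom.commutes, map_zero] at h
  exact mul_self_of_quadratic hk h

theorem gen_V1check_mul_self (hu : u₁ ≠ 0) :
    gen r k₁ u₁ V1check * gen r k₁ u₁ V1check = (u₁ - u₁⁻¹) • gen r k₁ u₁ V1check + 1 := by
  have h := RingQuot.mkAlgHom_rel ℂ (HIIIRel.rel4 (r := r) (k₁ := k₁) (u₁ := u₁))
  rw [map_mul, map_sub, map_add, AlgHom.commutes, AlgHom.commutes, map_zero] at h
  exact mul_self_of_quadratic hu h

theorem gen_V0check : gen r k₁ u₁ V0check =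
    r • (gen r k₁ u₁ V1check * gen r k₁ u₁ V1 * gen r k₁ u₁ V0) -
      algebraMap ℂ (HIII r k₁ u₁) r⁻¹ := by
  have h := RingQuot.mkAlgHom_rel ℂ (HIIIRel.rel5 (r := r) (k₁ := k₁) (u₁ := u₁))
  rw [map_smul, map_mul, map_mul, map_add, AlgHom.commutes] at h
  exact eq_sub_of_add_eq h.symm

theorem gen_V0 : gen r k₁ u₁ V0 =
    r • (gen r k₁ u₁ V0check * gen r k₁ u₁ V1check * gen r k₁ u₁ V1) := by
  have h := RingQuot.mkAlgHom_rel ℂ (HIIIRel.rel6 (r := r) (k₁ := k₁) (u₁ := u₁))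
  rw [map_smul, map_mul, map_mul] at h
  exact h.symm

/-- The invertible element `V̌₁ V₁`. -/
noncomputable def translation (r : ℂ) (hk : k₁ ≠ 0) (hu : u₁ ≠ 0) : (HIII r k₁ u₁)ˣ :=
  quadraticUnit (gen_V1_mul_self hk) (gen_V1check_mul_self hu)

/-- Substituting the formula for V̌₀ from the fifth relation into the sixth leaves a relation
between w and V₀ alone; cancelling w on either side gives the two exchange rules below. -/
theorem translation_mul_V0_mul_translation (hr : r ≠ 0) (hk : k₁ ≠ 0) (hu : u₁ ≠ 0) :
    r ^ 2 • ((translation r hk hu : HIII r k₁ u₁) * gen r k₁ u₁ V0 * translation r hk hu) =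
      gen r k₁ u₁ V0 + translation r hk hu := by
  have h := gen_V0 (r := r) (k₁ := k₁) (u₁ := u₁)
  rw [gen_V0check, mul_assoc] at h
  change _ = r • ((r • ((translation r hk hu : HIII r k₁ u₁) * _) - _) *
    (translation r hk hu : HIII r k₁ u₁)) at h
  rw [sub_mul, smul_sub, ← Algebra.smul_def, smul_smul, mul_inv_cancel₀ hr, one_smul,
    smul_mul_assoc, smul_smul] at h
  rw [eq_sub_iff_add_eq] at h
  rw [h, sq]

theorem gen_V0_mul_translation (hr : r ≠ 0) (hk : k₁ ≠ 0) (hu : u₁ ≠ 0) :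
    r ^ 2 • (gen r k₁ u₁ V0 * (translation r hk hu : HIII r k₁ u₁)) =
      (((translation r hk hu)⁻¹ : (HIII r k₁ u₁)ˣ) : HIII r k₁ u₁) * gen r k₁ u₁ V0 + 1 := by
  have h := congrArg ((((translation r hk hu)⁻¹ : (HIII r k₁ u₁)ˣ) : HIII r k₁ u₁) * ·)
    (translation_mul_V0_mul_translation hr hk hu)
  simpa [mul_add, mul_assoc] using h

theorem translation_mul_gen_V0 (hr : r ≠ 0) (hk : k₁ ≠ 0) (hu : u₁ ≠ 0) :
    r ^ 2 • ((translation r hk hu : HIII r k₁ u₁) * gen r k₁ u₁ V0) =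
      gen r k₁ u₁ V0 * (((translation r hk hu)⁻¹ : (HIII r k₁ u₁)ˣ) : HIII r k₁ u₁) + 1 := by
  have h := congrArg (· * (((translation r hk hu)⁻¹ : (HIII r k₁ u₁)ˣ) : HIII r k₁ u₁))
    (translation_mul_V0_mul_translation hr hk hu)
  simpa [add_mul, mul_assoc] using h

/-- The span contains 1 and is stable under left multiplication by every generator: V₁ and V₀ by the
exchange rules, V̌₀ and V̌₁ because they are expressible through w, V₁ and V₀. -/
theorem wordSpan_eq_top (hr : r ≠ 0) (hk : k₁ ≠ 0) (hu : u₁ ≠ 0) :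
    wordSpan (translation r hk hu) (gen r k₁ u₁ V1) (gen r k₁ u₁ V0) = ⊤ := by
  set S := wordSpan (translation r hk hu) (gen r k₁ u₁ V1) (gen r k₁ u₁ V0) with hS
  have hw (z) (hz : z ∈ S) : (translation r hk hu : HIII r k₁ u₁) * z ∈ S := by
    simpa using zpow_mul_mem_wordSpan 1 hz
  have hV1 (z) (hz : z ∈ S) : gen r k₁ u₁ V1 * z ∈ S :=
    mul_mem_wordSpan_of_quadratic (gen_V1_mul_self hk)
      (mul_quadraticUnit (gen_V1_mul_self hk) (gen_V1check_mul_self hu))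
      (mul_quadraticUnit_inv (gen_V1_mul_self hk) (gen_V1check_mul_self hu)) hz
  have hV0 (z) (hz : z ∈ S) : gen r k₁ u₁ V0 * z ∈ S :=
    mul_mem_wordSpan_of_sq_zero (pow_ne_zero 2 hr) gen_V0_mul_self
      (translation_mul_gen_V0 hr hk hu) (gen_V0_mul_translation hr hk hu) hz
  have hV0check (z) (hz : z ∈ S) : gen r k₁ u₁ V0check * z ∈ S := by
    rw [gen_V0check, sub_mul, smul_mul_assoc, mul_assoc, ← Algebra.smul_def]
    exact sub_mem (Submodule.smul_mem _ _ (hw _ (hV0 _ hz))) (Submodule.smul_mem _ _ hz)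
  have hV1check (z) (hz : z ∈ S) : gen r k₁ u₁ V1check * z ∈ S := by
    have e : gen r k₁ u₁ V1check = (translation r hk hu : HIII r k₁ u₁) *
        (gen r k₁ u₁ V1 - algebraMap ℂ _ (k₁ - k₁⁻¹)) := by
      change _ = gen r k₁ u₁ V1check * gen r k₁ u₁ V1 * _
      rw [mul_assoc, mul_sub, gen_V1_mul_self hk, ← Algebra.commutes, ← Algebra.smul_def,
        add_sub_cancel_left, mul_one]
    rw [e, mul_assoc, sub_mul, ← Algebra.smul_def]
    exact hw _ (sub_mem (hV1 _ hz) (Submodule.smul_mem _ _ hz))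
  have key (y : FreeAlgebra ℂ HIIIGen) : ∀ z ∈ S, mk r k₁ u₁ y * z ∈ S := by
    induction y using FreeAlgebra.induction with
    | grade0 c =>
      intro z hz
      rw [AlgHom.commutes, ← Algebra.smul_def]
      exact Submodule.smul_mem _ _ hz
    | grade1 g =>
      cases g
      exacts [hV0, hV1, hV0check, hV1check]
    | mul y y' h h' =>
      intro z hz
      rw [map_mul, mul_assoc]
      exact h _ (h' _ hz)
    | add y y' h h' =>
      intro z hz
      rw [map_add, add_mul]
      exact add_mem (h _ hz) (h' _ hz)
  have h1 : (1 : HIII r k₁ u₁) ∈ S := by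
    simpa [leftWord] using leftWord_mem_wordSpan (w := translation r hk hu)
      (a := gen r k₁ u₁ V1) (x := gen r k₁ u₁ V0) (0, false, 0)
  rw [eq_top_iff]
  intro h _
  obtain ⟨y, rfl⟩ := RingQuot.mkAlgHom_surjective ℂ (HIIIRel r k₁ u₁) h
  exact mul_one (mk r k₁ u₁ y) ▸ key y 1 h1

theorem lift_rel (hr : r ≠ 0) (hk : k₁ ≠ 0) (hu : u₁ ≠ 0)
    ⦃x y : FreeAlgebra ℂ HIIIGen⦄ (h : HIIIRel r k₁ u₁ x y) :
    FreeAlgebra.lift ℂ (HIIIGen.rec (matV0 r) (matV1 r k₁) (matV0check r k₁ u₁)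
      (matV1check r u₁) : HIIIGen → MatTq r) x =
    FreeAlgebra.lift ℂ (HIIIGen.rec (matV0 r) (matV1 r k₁) (matV0check r k₁ u₁)
      (matV1check r u₁) : HIIIGen → MatTq r) y := by
  cases h with
  | rel1 => simpa using matV0_sq r
  | rel2 => simpa only [map_mul, map_sub, map_add, map_zero, FreeAlgebra.lift_ι_apply,
      AlgHom.commutes] using matV1_quadratic hk
  | rel3 => simpa using matV0check_quadratic
  | rel4 => simpa only [map_mul, map_sub, map_add, map_zero, FreeAlgebra.lift_ι_apply,
      AlgHom.commutes] using matV1check_quadratic hu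
  | rel5 => simpa only [map_mul, map_smul, map_add, FreeAlgebra.lift_ι_apply,
      AlgHom.commutes] using matV1check_mul_matV1_mul_matV0 hr
  | rel6 => simpa only [map_mul, map_smul, FreeAlgebra.lift_ι_apply]
      using matV0check_mul_matV1check_mul_matV1 hr

/-- The homomorphism from `H_III` to matrices over the quantum torus. -/
noncomputable def toMat (hr : r ≠ 0) (hk : k₁ ≠ 0) (hu : u₁ ≠ 0) : HIII r k₁ u₁ →ₐ[ℂ] MatTq r :=
  RingQuot.liftAlgHom ℂ ⟨FreeAlgebra.lift ℂ (HIIIGen.rec (matV0 r) (matV1 r k₁)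
    (matV0check r k₁ u₁) (matV1check r u₁)), lift_rel hr hk hu⟩

theorem toMat_gen (hr : r ≠ 0) (hk : k₁ ≠ 0) (hu : u₁ ≠ 0) (g : HIIIGen) :
    toMat hr hk hu (gen r k₁ u₁ g) = HIIIGen.rec (matV0 r) (matV1 r k₁)
      (matV0check r k₁ u₁) (matV1check r u₁) g := by
  have h := RingQuot.liftAlgHom_mkAlgHom_apply ℂ (FreeAlgebra.lift ℂ (HIIIGen.rec (matV0 r)
    (matV1 r k₁) (matV0check r k₁ u₁) (matV1check r u₁) : HIIIGen → MatTq r))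
    (lift_rel hr hk hu) g.free
  rw [FreeAlgebra.lift_ι_apply] at h
  exact h

end HIII

/-! ### Triangularity, and the effect of w on the lowest S₃-degree. -/

theorem linearIndependent_of_triangular {ι K V κ : Type*} [Field K] [AddCommGroup V] [Module K V]
    [LinearOrder κ] (key : ι → κ) (v : ι → V) (f : ι → V →ₗ[K] K) (hd : ∀ i, f i (v i) ≠ 0)
    (ht : ∀ i j, i ≠ j → key i ≤ key j → f i (v j) = 0) : LinearIndependent K v := by
  rw [linearIndependent_iff]
  intro l hl
  by_contra hne
  -- The functional of a minimal index in the support sees only its own term.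
  obtain ⟨i, hi, hmin⟩ := l.support.exists_min_image key (Finsupp.support_nonempty_iff.2 hne)
  have h := congrArg (f i) hl
  rw [Finsupp.linearCombination_apply, Finsupp.sum, map_sum, map_zero,
    Finset.sum_eq_single_of_mem i hi] at h
  · rw [map_smul, smul_eq_mul, mul_eq_zero] at h
    exact h.elim (Finsupp.mem_support_iff.1 hi) (hd i)
  · intro j hj hji
    rw [map_smul, ht i j hji.symm (hmin j hj), smul_zero]

/-- All coefficients in `S₃`-degree less than `d` vanish. -/
def VanishesBelow (v : Fin 2 → ℤ → ℤ → ℂ) (d : ℤ) : Prop :=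
  ∀ i s p, p < d → v i s p = 0

section

variable {r k₁ u₁ : ℂ} (hr : r ≠ 0) {v : Fin 2 → ℤ → ℤ → ℂ} {d : ℤ}

include hr

/-- Only the entry e^{S₁} of V̌₁, which is e^{-S₂-S₃} up to a scalar, lowers the S₃-degree. It
carries the second entry of V₁v into the first, and the S₂-shifts of the two factors cancel. -/
theorem matRep_V1check_mul_V1 (hv : VanishesBelow v d) :
    VanishesBelow (matRep hr (matV1check r u₁ * matV1 r k₁) v) (d - 1) ∧
    (∀ s, matRep hr (matV1check r u₁ * matV1 r k₁) v 1 s (d - 1) = 0) ∧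
    ∀ s, matRep hr (matV1check r u₁ * matV1 r k₁) v 0 s (d - 1) = 0 ↔
      v 0 s d + v 1 s d = 0 := by
  rw [map_mul, Module.End.mul_apply, matRep_V1check, matRep_V1]
  refine ⟨fun i s p hp => ?_, fun s => ?_, fun s => ?_⟩
  · fin_cases i
    · simp [hv _ _ (p + 1) (by omega)]
    · simp [hv _ _ (p - 1) (by omega), hv _ _ p (by omega)]
  · simp [hv _ _ (d - 1 - 1) (by omega), hv _ _ (d - 1) (by omega)]
  · simp [hr, zpow_ne_zero, Complex.I_ne_zero]

theorem matRep_inv_V1check_mul_V1 (κ : ℂ) (hv : VanishesBelow v d) :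
    VanishesBelow (matRep hr ((matV1 r k₁ - algebraMap ℂ (MatTq r) κ) *
      (matV1check r u₁ - algebraMap ℂ (MatTq r) (u₁ - u₁⁻¹))) v) (d - 1) ∧
    ∀ s, matRep hr ((matV1 r k₁ - algebraMap ℂ (MatTq r) κ) *
      (matV1check r u₁ - algebraMap ℂ (MatTq r) (u₁ - u₁⁻¹))) v 1 s (d - 1) = 0 ↔
      v 1 s d = 0 := by
  rw [map_mul, Module.End.mul_apply, map_sub, map_sub, AlgHom.commutes, AlgHom.commutes,
    LinearMap.sub_apply, LinearMap.sub_apply, matRep_V1check, matRep_V1,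
    Module.algebraMap_end_apply, Module.algebraMap_end_apply]
  refine ⟨fun i s p hp => ?_, fun s => ?_⟩
  · fin_cases i <;>
    simp [Matrix.vecHead, Matrix.vecTail, hv _ _ (p + 1) (by omega), hv _ _ (p - 1) (by omega), hv _ _ p (by omega)]
  · simp [Matrix.vecHead, Matrix.vecTail, hv _ _ (d - 1 - 1) (by omega), hv _ _ (d - 1) (by omega), hr, zpow_ne_zero,
      Complex.I_ne_zero]

/-- After one step the lowest part sits in the first entry only, so from then on the sum of entries
is that entry. For N = 0 the second entry need not vanish, hence the positivity condition. -/
theorem matRep_pow_V1check_mul_V1 (hv : VanishesBelow v d) (N : ℕ) :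
    VanishesBelow (matRep hr ((matV1check r u₁ * matV1 r k₁) ^ N) v) (d - N) ∧
    (0 < N → (∀ s, matRep hr ((matV1check r u₁ * matV1 r k₁) ^ N) v 1 s (d - N) = 0) ∧
      ∀ s, matRep hr ((matV1check r u₁ * matV1 r k₁) ^ N) v 0 s (d - N) = 0 ↔
        v 0 s d + v 1 s d = 0) := by
  induction N with
  | zero => simpa using hv
  | succ N ih =>
    rw [pow_succ', map_mul, Module.End.mul_apply, Nat.cast_succ, ← sub_sub]
    obtain ⟨h1, h2, h3⟩ := matRep_V1check_mul_V1 (k₁ := k₁) (u₁ := u₁) hr ih.1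
    refine ⟨h1, fun _ => ⟨h2, fun s => ?_⟩⟩
    rw [h3]
    rcases Nat.eq_zero_or_pos N with rfl | hN
    · simp
    · rw [(ih.2 hN).1, add_zero, (ih.2 hN).2]

theorem matRep_pow_inv_V1check_mul_V1 (κ : ℂ) (hv : VanishesBelow v d) (N : ℕ) :
    VanishesBelow (matRep hr (((matV1 r k₁ - algebraMap ℂ (MatTq r) κ) *
      (matV1check r u₁ - algebraMap ℂ (MatTq r) (u₁ - u₁⁻¹))) ^ N) v) (d - N) ∧
    ∀ s, matRep hr (((matV1 r k₁ - algebraMap ℂ (MatTq r) κ) *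
      (matV1check r u₁ - algebraMap ℂ (MatTq r) (u₁ - u₁⁻¹))) ^ N) v 1 s (d - N) = 0 ↔
      v 1 s d = 0 := by
  induction N with
  | zero => simpa using hv
  | succ N ih =>
    rw [pow_succ', map_mul, Module.End.mul_apply, Nat.cast_succ, ← sub_sub]
    obtain ⟨h1, h2⟩ := matRep_inv_V1check_mul_V1 (k₁ := k₁) (u₁ := u₁) hr κ ih.1
    refine ⟨h1, fun s => ?_⟩
    rw [h2, ih.2]

end

/-! ### Supports of the columns (V₀V₁)ᵐ and V₁(V₀V₁)ᵐ applied to the vacuum. -/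

/-- The column with entries `0` and `1`, as a column of coefficient arrays. -/
def vacuum : Fin 2 → ℤ → ℤ → ℂ := ![0, Pi.single 0 (Pi.single 0 1)]

section

variable {r : ℂ} (k₁ : ℂ) (hr : r ≠ 0)

/-- The column obtained by applying `(V₀ V₁)ᵐ` to the vacuum. -/
noncomputable def powVacuum (m : ℕ) : Fin 2 → ℤ → ℤ → ℂ :=
  matRep hr ((matV0 r * matV1 r k₁) ^ m) vacuum

theorem powVacuum_zero : powVacuum k₁ hr 0 = vacuum := by simp [powVacuum]

theorem powVacuum_succ (m : ℕ) :
    powVacuum k₁ hr (m + 1) = matRep hr (matV0 r) (matRep hr (matV1 r k₁) (powVacuum k₁ hr m)) := by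
  rw [powVacuum, pow_succ', map_mul, map_mul, Module.End.mul_apply, Module.End.mul_apply, powVacuum]

theorem powVacuum_fst (m : ℕ) : powVacuum k₁ hr m 0 = 0 := by
  cases m with
  | zero => simp [powVacuum_zero, vacuum]
  | succ m => simp [powVacuum_succ, matRep_V0]

/-- This recursion raises the S₃-degree by one and widens the S₂-support by one on each side; the
extreme coefficients have a single contributing neighbour and so stay nonzero. -/
theorem powVacuum_succ_snd (m : ℕ) (s p : ℤ) :
    powVacuum k₁ hr (m + 1) 1 s p = Complex.I * r ^ s *
      ((k₁ - k₁⁻¹) * powVacuum k₁ hr m 1 s (p - 1)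
        - Complex.I * r ^ (-(p - 1)) * powVacuum k₁ hr m 1 (s - 1) (p - 1)
        - Complex.I * r ^ (p - 1) * powVacuum k₁ hr m 1 (s + 1) (p - 1)) := by
  rw [powVacuum_succ, matRep_V0, matRep_V1]
  simp only [Matrix.cons_val_zero, Matrix.cons_val_one, powVacuum_fst, Pi.zero_apply, zero_add]

theorem powVacuum_snd_of_ne (m : ℕ) (s p : ℤ) (hp : p ≠ m) : powVacuum k₁ hr m 1 s p = 0 := by
  induction m generalizing s p with
  | zero =>
    rw [powVacuum_zero]
    have hp' : p ≠ 0 := by simpa using hp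
    by_cases hs : s = 0
    · subst hs
      simp [vacuum, hp']
    · simp [vacuum, hs]
  | succ m ih =>
    have h (s : ℤ) : powVacuum k₁ hr m 1 s (p - 1) = 0 := ih s (p - 1) (by push_cast at hp; omega)
    simp [powVacuum_succ_snd, h]

theorem powVacuum_snd_of_lt (m : ℕ) (s p : ℤ) (hs : s < -m ∨ m < s) :
    powVacuum k₁ hr m 1 s p = 0 := by
  induction m generalizing s p with
  | zero =>
    have hs' : s ≠ 0 := by rcases hs with hs | hs <;> simp at hs <;> omega
    simp [powVacuum_zero, vacuum, hs']
  | succ m ih =>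
    push_cast at hs
    rw [powVacuum_succ_snd, ih s _ (by omega), ih (s - 1) _ (by omega), ih (s + 1) _ (by omega)]
    simp

theorem powVacuum_snd_top (m : ℕ) : powVacuum k₁ hr m 1 m m ≠ 0 := by
  induction m with
  | zero => simp [powVacuum_zero, vacuum]
  | succ m ih =>
    rw [powVacuum_succ_snd, powVacuum_snd_of_lt k₁ hr m ((m + 1 : ℕ) : ℤ) _ (by omega),
      powVacuum_snd_of_lt k₁ hr m (((m + 1 : ℕ) : ℤ) + 1) _ (by omega)]
    push_cast
    rw [add_sub_cancel_right]
    simp [hr, zpow_ne_zero, ih]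

theorem powVacuum_snd_bot (m : ℕ) : powVacuum k₁ hr m 1 (-m) m ≠ 0 := by
  induction m with
  | zero => simp [powVacuum_zero, vacuum]
  | succ m ih =>
    rw [powVacuum_succ_snd, powVacuum_snd_of_lt k₁ hr m (-((m + 1 : ℕ) : ℤ)) _ (by omega),
      powVacuum_snd_of_lt k₁ hr m (-((m + 1 : ℕ) : ℤ) - 1) _ (by omega)]
    push_cast
    rw [add_sub_cancel_right, neg_add, neg_add_cancel_right]
    simp [hr, zpow_ne_zero, ih]

/-- The column obtained by applying `V₁ᵉ (V₀ V₁)ᵐ` to the vacuum. -/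
noncomputable def wordVacuum (e : Bool) (m : ℕ) : Fin 2 → ℤ → ℤ → ℂ :=
  matRep hr (if e then matV1 r k₁ else 1) (powVacuum k₁ hr m)

theorem wordVacuum_false (m : ℕ) : wordVacuum k₁ hr false m = powVacuum k₁ hr m := by
  simp [wordVacuum]

theorem wordVacuum_true_snd (m : ℕ) (s p : ℤ) : wordVacuum k₁ hr true m 1 s p =
    Complex.I * r ^ (-p) * powVacuum k₁ hr m 1 (s - 1) p := by
  simp [wordVacuum, matRep_V1, powVacuum_fst]

/-- The e^{S₂} terms cancel in the sum of the two rows of V₁. The sum of entries thus reaches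
S₂-degree -m - 1, whereas the second entry alone reaches m + 1. -/
theorem wordVacuum_true_add (m : ℕ) (s p : ℤ) :
    wordVacuum k₁ hr true m 0 s p + wordVacuum k₁ hr true m 1 s p =
      (k₁ - k₁⁻¹) * powVacuum k₁ hr m 1 s p
        - Complex.I * r ^ p * powVacuum k₁ hr m 1 (s + 1) p := by
  simp only [wordVacuum, matRep_V1, if_true, Matrix.cons_val_zero, Matrix.cons_val_one,
    powVacuum_fst, Pi.zero_apply, zero_add]
  ring

theorem vanishesBelow_wordVacuum (e : Bool) (m : ℕ) : VanishesBelow (wordVacuum k₁ hr e m) m := by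
  intro i s p hp
  have h (s : ℤ) : powVacuum k₁ hr m 1 s p = 0 := powVacuum_snd_of_ne k₁ hr m s p hp.ne
  cases e <;> fin_cases i <;>
    simp [wordVacuum, matRep_V1, powVacuum_fst, h]

end

/-! ### Linear independence on the vacuum and injectivity. -/

section

variable {r k₁ u₁ : ℂ} (hr : r ≠ 0) (hk : k₁ ≠ 0) (hu : u₁ ≠ 0)

/-- The action of `H_III` on columns of coefficient arrays. -/
noncomputable def HIII.rep : HIII r k₁ u₁ →ₐ[ℂ] Module.End ℂ (Fin 2 → ℤ → ℤ → ℂ) :=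
  (matRep hr).comp (HIII.toMat hr hk hu)

open HIII HIIIGen

/-- The column obtained by applying `(V̌₁ V₁)ⁿ V₁ᵉ (V₀ V₁)ᵐ` to the vacuum. -/
noncomputable def leftWordVacuum (i : ℤ × Bool × ℕ) : Fin 2 → ℤ → ℤ → ℂ :=
  rep hr hk hu (leftWord (translation r hk hu) (gen r k₁ u₁ V1) (gen r k₁ u₁ V0) i) vacuum

theorem leftWordVacuum_eq (n : ℤ) (e : Bool) (m : ℕ) :
    leftWordVacuum hr hk hu (n, e, m) =
      matRep hr (toMat hr hk hu ((translation r hk hu ^ n : (HIII r k₁ u₁)ˣ) : HIII r k₁ u₁))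
        (wordVacuum k₁ hr e m) := by
  simp only [leftWordVacuum, leftWord, rep, AlgHom.comp_apply, map_mul, map_pow,
    Module.End.mul_apply, wordVacuum, powVacuum]
  cases e <;> simp [toMat_gen]

theorem leftWordVacuum_natCast (N : ℕ) (e : Bool) (m : ℕ) :
    leftWordVacuum hr hk hu (N, e, m) =
      matRep hr ((matV1check r u₁ * matV1 r k₁) ^ N) (wordVacuum k₁ hr e m) := by
  have h : toMat hr hk hu (translation r hk hu) = matV1check r u₁ * matV1 r k₁ := by
    change toMat hr hk hu (gen r k₁ u₁ V1check * gen r k₁ u₁ V1) = _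
    rw [map_mul, toMat_gen, toMat_gen]
  rw [leftWordVacuum_eq, zpow_natCast, Units.val_pow_eq_pow_val, map_pow, h]

theorem leftWordVacuum_neg_natCast (N : ℕ) (e : Bool) (m : ℕ) :
    leftWordVacuum hr hk hu (-(N : ℤ), e, m) =
      matRep hr (((matV1 r k₁ - algebraMap ℂ (MatTq r) (k₁ - k₁⁻¹)) *
        (matV1check r u₁ - algebraMap ℂ (MatTq r) (u₁ - u₁⁻¹))) ^ N) (wordVacuum k₁ hr e m) := by
  have h : toMat hr hk hu (((translation r hk hu)⁻¹ : (HIII r k₁ u₁)ˣ) : HIII r k₁ u₁) =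
      (matV1 r k₁ - algebraMap ℂ (MatTq r) (k₁ - k₁⁻¹)) *
        (matV1check r u₁ - algebraMap ℂ (MatTq r) (u₁ - u₁⁻¹)) := by
    change toMat hr hk hu ((gen r k₁ u₁ V1 - algebraMap ℂ _ (k₁ - k₁⁻¹)) *
      (gen r k₁ u₁ V1check - algebraMap ℂ _ (u₁ - u₁⁻¹))) = _
    rw [map_mul, map_sub _ (gen r k₁ u₁ V1), map_sub _ (gen r k₁ u₁ V1check), AlgHom.commutes,
      AlgHom.commutes, toMat_gen, toMat_gen]
  rw [leftWordVacuum_eq, zpow_neg, zpow_natCast, ← inv_pow, Units.val_pow_eq_pow_val, map_pow, h]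

theorem vanishesBelow_leftWordVacuum (n : ℤ) (e : Bool) (m : ℕ) :
    VanishesBelow (leftWordVacuum hr hk hu (n, e, m)) (m - |n|) := by
  obtain ⟨N, rfl | rfl⟩ := n.eq_nat_or_neg
  · rw [leftWordVacuum_natCast, Nat.abs_cast]
    exact (matRep_pow_V1check_mul_V1 hr (vanishesBelow_wordVacuum k₁ hr e m) N).1
  · rw [leftWordVacuum_neg_natCast, abs_neg, Nat.abs_cast]
    exact (matRep_pow_inv_V1check_mul_V1 hr _ (vanishesBelow_wordVacuum k₁ hr e m) N).1

theorem leftWordVacuum_snd_of_pos {n : ℤ} (hn : 0 < n) (e : Bool) (m : ℕ) (s : ℤ) :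
    leftWordVacuum hr hk hu (n, e, m) 1 s (m - n) = 0 := by
  lift n to ℕ using hn.le
  rw [leftWordVacuum_natCast]
  exact ((matRep_pow_V1check_mul_V1 hr (vanishesBelow_wordVacuum k₁ hr e m) n).2
    (by exact_mod_cast hn)).1 s

theorem leftWordVacuum_fst_of_pos {n : ℤ} (hn : 0 < n) (e : Bool) (m : ℕ) (s : ℤ) :
    leftWordVacuum hr hk hu (n, e, m) 0 s (m - n) = 0 ↔
      wordVacuum k₁ hr e m 0 s m + wordVacuum k₁ hr e m 1 s m = 0 := by
  lift n to ℕ using hn.le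
  rw [leftWordVacuum_natCast]
  exact ((matRep_pow_V1check_mul_V1 hr (vanishesBelow_wordVacuum k₁ hr e m) n).2
    (by exact_mod_cast hn)).2 s

theorem leftWordVacuum_snd_of_nonpos {n : ℤ} (hn : n ≤ 0) (e : Bool) (m : ℕ) (s : ℤ) :
    leftWordVacuum hr hk hu (n, e, m) 1 s (m + n) = 0 ↔ wordVacuum k₁ hr e m 1 s m = 0 := by
  obtain ⟨N, rfl⟩ := Int.exists_eq_neg_ofNat hn
  rw [leftWordVacuum_neg_natCast, ← sub_eq_add_neg]
  exact (matRep_pow_inv_V1check_mul_V1 hr _ (vanishesBelow_wordVacuum k₁ hr e m) N).2 s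

/-- The coefficient detecting the word `(n, e, m)` among those with larger key. -/
def leadCoeff (i : ℤ × Bool × ℕ) : (Fin 2 → ℤ → ℤ → ℂ) →ₗ[ℂ] ℂ where
  toFun v := if 0 < i.1 then v 0 (if i.2.1 then -i.2.2 - 1 else i.2.2) (i.2.2 - i.1)
    else v 1 (if i.2.1 then i.2.2 + 1 else -i.2.2) (i.2.2 + i.1)
  map_add' v w := by
    split_ifs <;> rfl
  map_smul' c v := by
    split_ifs <;> rfl

/-- The key ordering the words by lowest degree, then by sign of `n`, then by `-m`. -/
def wordKey (i : ℤ × Bool × ℕ) : ℤ ×ₗ Bool ×ₗ ℤ ×ₗ Bool :=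
  toLex (i.2.2 - |i.1|, toLex (decide (0 < i.1), toLex (-i.2.2, !i.2.1)))

/-- The chosen S₂-degree is an extreme one: for n > 0, m or -m - 1 in the sum of entries; for n ≤ 0,
-m or m + 1 in the second entry. The value is a nonzero multiple of an end coefficient of
`powVacuum`. -/
theorem leadCoeff_leftWordVacuum_self (i : ℤ × Bool × ℕ) :
    leadCoeff i (leftWordVacuum hr hk hu i) ≠ 0 := by
  obtain ⟨n, e, m⟩ := i
  have ht := powVacuum_snd_top k₁ hr m
  have hb := powVacuum_snd_bot k₁ hr m
  have hb' : powVacuum k₁ hr m 1 (-m - 1) m = 0 := powVacuum_snd_of_lt k₁ hr m _ _ (by omega)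
  by_cases hn : 0 < n
  · simp only [leadCoeff, LinearMap.coe_mk, AddHom.coe_mk, hn, if_true, ne_eq]
    rw [leftWordVacuum_fst_of_pos hr hk hu hn]
    cases e
    · simpa [wordVacuum_false, powVacuum_fst] using ht
    · rw [wordVacuum_true_add]
      simp [hb', hb, hr]
  · simp only [leadCoeff, LinearMap.coe_mk, AddHom.coe_mk, hn, if_false, ne_eq]
    rw [leftWordVacuum_snd_of_nonpos hr hk hu (not_lt.1 hn)]
    cases e
    · simpa [wordVacuum_false] using hb
    · rw [wordVacuum_true_snd]
      simp [ht, hr]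

/-- A larger key means a higher bottom degree, or n' > 0 against n ≤ 0, or a narrower S₂-support
because m' < m, or a tie in m settled by e. -/
theorem leadCoeff_leftWordVacuum_of_le {i j : ℤ × Bool × ℕ} (hij : i ≠ j)
    (h : wordKey i ≤ wordKey j) : leadCoeff i (leftWordVacuum hr hk hu j) = 0 := by
  obtain ⟨n, e, m⟩ := i
  obtain ⟨n', e', m'⟩ := j
  simp only [wordKey, Prod.Lex.toLex_le_toLex] at h
  by_cases hn : 0 < n
  · simp only [leadCoeff, LinearMap.coe_mk, AddHom.coe_mk, hn, if_true]
    rw [abs_of_pos hn] at h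
    rcases h with h | ⟨hd, h⟩
    · exact vanishesBelow_leftWordVacuum hr hk hu n' e' m' _ _ _ h
    have hn' : 0 < n' := by
      by_contra hn'
      simp [hn, hn', Bool.lt_iff] at h
    rw [abs_of_pos hn'] at hd
    -- For n > 0 the tie-break has a direction: the position -m - 1 misses the word with e' = false,
    -- but the position m can meet the one with e' = true.
    have hm : m' < m ∨ m' = m ∧ e = true ∧ e' = false := by
      simp only [hn, hn', decide_true, lt_self_iff_false, true_and, false_or] at h
      rcases h with h | ⟨h1, h2⟩
      · left
        omega
      · right
        have hmm : m' = m := by omega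
        refine ⟨hmm, ?_⟩
        have hne : e ≠ e' := by
          rintro rfl
          exact hij (by rw [hmm, show n = n' by omega])
        revert h2 hne
        cases e <;> cases e' <;> simp
    rw [hd, leftWordVacuum_fst_of_pos hr hk hu hn']
    rcases hm with hm | ⟨rfl, rfl, rfl⟩
    · cases e'
      · rw [wordVacuum_false, powVacuum_fst,
          powVacuum_snd_of_lt k₁ hr m' _ _ (by split_ifs <;> omega)]
        simp
      · rw [wordVacuum_true_add, powVacuum_snd_of_lt k₁ hr m' _ _ (by split_ifs <;> omega),
          powVacuum_snd_of_lt k₁ hr m' _ _ (by split_ifs <;> omega)]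
        simp
    · rw [wordVacuum_false, powVacuum_fst, powVacuum_snd_of_lt k₁ hr m' _ _ (by simp)]
      simp
  · simp only [leadCoeff, LinearMap.coe_mk, AddHom.coe_mk, hn, if_false]
    rw [abs_of_nonpos (not_lt.1 hn), sub_neg_eq_add] at h
    rcases h with h | ⟨hd, h⟩
    · exact vanishesBelow_leftWordVacuum hr hk hu n' e' m' _ _ _ h
    by_cases hn' : 0 < n'
    -- Columns with n' > 0 have no second entry in their lowest degree.
    · rw [hd, abs_of_pos hn', leftWordVacuum_snd_of_pos hr hk hu hn']
    rw [abs_of_nonpos (not_lt.1 hn'), sub_neg_eq_add] at hd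
    have hm : m' < m ∨ m' = m ∧ e ≠ e' := by
      simp only [hn, hn', decide_false, lt_self_iff_false, true_and, false_or] at h
      rcases h with h | ⟨h1, h2⟩
      · left
        omega
      · right
        have hmm : m' = m := by omega
        refine ⟨hmm, ?_⟩
        rintro rfl
        exact hij (by rw [hmm, show n = n' by omega])
    rw [hd, leftWordVacuum_snd_of_nonpos hr hk hu (not_lt.1 hn')]
    cases e'
    · rw [wordVacuum_false, powVacuum_snd_of_lt k₁ hr m']
      cases e <;> simp at hm ⊢ <;> omega
    · rw [wordVacuum_true_snd, powVacuum_snd_of_lt k₁ hr m', mul_zero]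
      cases e <;> simp at hm ⊢ <;> omega

theorem linearIndependent_leftWordVacuum : LinearIndependent ℂ (leftWordVacuum hr hk hu) :=
  linearIndependent_of_triangular wordKey _ leadCoeff (leadCoeff_leftWordVacuum_self hr hk hu)
    fun _ _ => leadCoeff_leftWordVacuum_of_le hr hk hu

theorem eq_zero_of_rep_vacuum_eq_zero {h : HIII r k₁ u₁}
    (hmem : h ∈ Submodule.span ℂ (Set.range
      (leftWord (translation r hk hu) (gen r k₁ u₁ V1) (gen r k₁ u₁ V0))))
    (h0 : rep hr hk hu h vacuum = 0) : h = 0 := by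
  obtain ⟨c, rfl⟩ := Finsupp.mem_span_range_iff_exists_finsupp.1 hmem
  have hc : c = 0 := by
    refine linearIndependent_iff.1 (linearIndependent_leftWordVacuum hr hk hu) c ?_
    rw [Finsupp.linearCombination_apply, ← h0]
    simp [Finsupp.sum, leftWordVacuum]
  simp [hc]

theorem HIII.rep_V0_vacuum : rep hr hk hu (gen r k₁ u₁ V0) vacuum = 0 := by
  rw [rep, AlgHom.comp_apply, toMat_gen, matRep_V0]
  ext i s p
  fin_cases i <;> simp [vacuum]

theorem HIII.exists_rep_V0_eq_vacuum : ∃ v, rep hr hk hu (gen r k₁ u₁ V0) v = vacuum := by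
  -- V₀ multiplies by i e^{S₃}, so -i e^{-S₃} in the first entry is sent to 1 in the second.
  refine ⟨![Pi.single 0 (Pi.single (-1) (-Complex.I)), 0], ?_⟩
  rw [rep, AlgHom.comp_apply, toMat_gen, matRep_V0]
  ext i s p
  fin_cases i
  · simp [vacuum]
  · by_cases hs : s = 0
    · subst hs
      by_cases hp : p = 0
      · subst hp
        simp [vacuum]
      · have hp' : p - 1 ≠ -1 := by omega
        simp [vacuum, hp, hp']
    · simp [vacuum, hs]

theorem HIII.toMat_injective : Function.Injective (toMat (r := r) hr hk hu) := by
  rw [injective_iff_map_eq_zero]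
  intro h hh
  have hρ : rep hr hk hu h = 0 := by rw [rep, AlgHom.comp_apply, hh, map_zero]
  have hmem : h ∈ wordSpan (translation r hk hu) (gen r k₁ u₁ V1) (gen r k₁ u₁ V0) := by
    rw [wordSpan_eq_top hr hk hu]
    trivial
  obtain ⟨y, hy, _, ⟨z, hz, rfl⟩, rfl⟩ := Submodule.mem_sup.1 hmem
  simp only [LinearMap.mulRight_apply, map_add, map_mul] at hρ ⊢
  have hy0 : y = 0 := by
    refine eq_zero_of_rep_vacuum_eq_zero hr hk hu hy ?_
    simpa [rep_V0_vacuum] using LinearMap.congr_fun hρ vacuum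
  have hz0 : z = 0 := by
    obtain ⟨v, hv⟩ := exists_rep_V0_eq_vacuum (r := r) hr hk hu
    refine eq_zero_of_rep_vacuum_eq_zero hr hk hu hz ?_
    simpa [hy0, hv] using LinearMap.congr_fun hρ v
  rw [hy0, hz0, zero_mul, add_zero]

end

theorem mainTheorem6 (q r k₁ u₁ : ℂ) (hr : r ^ 2 = q) (hq0 : q ≠ 0)
    (hq : ∀ m : ℕ, 0 < m → q ^ m ≠ 1) (hk₁ : k₁ ≠ 0) (hu₁ : u₁ ≠ 0) :
    (matV0 r ^ 2 = 0 ∧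
      (matV1 r k₁ - algebraMap ℂ (MatTq r) k₁) * (matV1 r k₁ + algebraMap ℂ (MatTq r) k₁⁻¹) = 0 ∧
      matV0check r k₁ u₁ ^ 2 + r⁻¹ • matV0check r k₁ u₁ = 0 ∧
      (matV1check r u₁ - algebraMap ℂ (MatTq r) u₁) *
        (matV1check r u₁ + algebraMap ℂ (MatTq r) u₁⁻¹) = 0 ∧
      r • (matV1check r u₁ * matV1 r k₁ * matV0 r) =
        matV0check r k₁ u₁ + algebraMap ℂ (MatTq r) r⁻¹ ∧
      r • (matV0check r k₁ u₁ * matV1check r u₁ * matV1 r k₁) = matV0 r) ∧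
    ∃ φ : HIII r k₁ u₁ →ₐ[ℂ] MatTq r,
      φ (HIII.gen r k₁ u₁ HIIIGen.V0) = matV0 r ∧
      φ (HIII.gen r k₁ u₁ HIIIGen.V1) = matV1 r k₁ ∧
      φ (HIII.gen r k₁ u₁ HIIIGen.V0check) = matV0check r k₁ u₁ ∧
      φ (HIII.gen r k₁ u₁ HIIIGen.V1check) = matV1check r u₁ ∧
      Function.Injective φ := by
  have hr0 : r ≠ 0 := by
    rintro rfl
    exact hq0 (by simp [← hr])
  exact ⟨⟨matV0_sq r, matV1_quadratic hk₁, matV0check_quadratic, matV1check_quadratic hu₁,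
      matV1check_mul_matV1_mul_matV0 hr0, matV0check_mul_matV1check_mul_matV1 hr0⟩,
    HIII.toMat hr0 hk₁ hu₁, HIII.toMat_gen _ _ _ _, HIII.toMat_gen _ _ _ _,
    HIII.toMat_gen _ _ _ _, HIII.toMat_gen _ _ _ _, HIII.toMat_injective hr0 hk₁ hu₁⟩
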